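/- An $\ell$-group is a Hausdorff, locally compact, totally disconnected topological group; an $\ell_c$-group is an $\ell$-group $G$ which is the filtered union of its compact open subgroups, i.e. every element of $G$ lies in a compact open subgroup and any two compact open subgroups are contained in a third. A complex representation $(\pi,V)$ of an $\ell$-group $G$ is smooth if the action map $G\times V\to V$ is continuous for the discrete topology on $V$ (equivalently, every vector has an open stabilizer), and a smooth representation is admissible if for every compact open subgroup $K\subset G$ the space $V^K$ of $K$-fixed vectors is finite-dimensional. The group $G$ is tame if all of its irreducible smooth representations are admissible. Write $\mathcal R(G)$ for the category of smooth representations of $G$ and $\widehat G$ for the set of isomorphism classes of irreducible smooth representations of $G$. For a smooth representation $(\pi,V)$, let $V^\vee$ denote the space of linear functionals on $V$ whose stabilizer in $G$ is open. The Fell topology on $\widehat G$ is the topology in which a neighborhood basis of $(\pi,V)\in\widehat G$ is given by the sets $\mathscr U(\pi,v_j,\xi_j,B,\epsilon)$, for $v_1,\dots,v_n\in V$, $\xi_1,\dots,\xi_n\in V^\vee$, $B\subset G$ compact and $\epsilon>0$, where $\mathscr U(\pi,v_j,\xi_j,B,\epsilon)$ consists of those $(\rho,W)\in\widehat G$ for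 which there are $w_1,\dots,w_n\in W$ and $\zeta_1,\dots,\zeta_n\in W^\vee$ with \[ \big|\langle \xi_j,\pi(g)v_j\rangle-\langle\zeta_j,\rho(g)w_j\rangle\big|<\epsilon\qquad\text{for all }1\le j\le n\text{ and }g\in B. \] Let $G$ be a tame $\ell_c$-group and let $\pi$ be an irreducible smooth representation of $G$. Then $\pi$ is a projective object of $\mathcal R(G)$ if and only if its class is an open point of $\widehat G$ for the Fell topology, i.e. $\{\pi\}$ is open in $\widehat G$. -/

import Mathlib

open CategoryTheory

universe u

/-- An `ℓ`-group: a Hausdorff, locally compact, totally disconnected topological group. -/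
class IsEllGroup (G : Type u) [Group G] [TopologicalSpace G] : Prop extends
  IsTopologicalGroup G, T2Space G, LocallyCompactSpace G, TotallyDisconnectedSpace G

/-- An `ℓ_c`-group: an `ℓ`-group which is the filtered union of its compact open subgroups. -/
class IsEllCGroup (G : Type u) [Group G] [TopologicalSpace G] : Prop extends IsEllGroup G where
  exists_mem_compact_open : ∀ g : G, ∃ K : OpenSubgroup G, IsCompact (K : Set G) ∧ g ∈ K
  directed_compact_open : ∀ K L : OpenSubgroup G, IsCompact (K : Set G) → IsCompact (L : Set G) →
    ∃ M : OpenSubgroup G, IsCompact (M : Set G) ∧ K ≤ M ∧ L ≤ M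

namespace Representation

variable {G : Type u} [Group G] {V : Type*} [AddCommGroup V] [Module ℂ V]

/-- A vector is smooth if its stabilizer is open. The smooth vectors of `ρ` form the smooth part
of `ρ`. -/
def IsSmoothVector [TopologicalSpace G] (ρ : Representation ℂ G V) (v : V) : Prop :=
  IsOpen {g : G | ρ g v = v}

/-- A representation is smooth if the action map `G × V → V` is continuous for the discrete
topology on `V`. -/
def IsSmooth [TopologicalSpace G] (ρ : Representation ℂ G V) : Prop :=
  letI : TopologicalSpace V := ⊥
  Continuous fun p : G × V => ρ p.1 p.2

/-- A representation is smooth if and only if all of its vectors are smooth. -/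
theorem isSmooth_iff [TopologicalSpace G] [ContinuousMul G] (ρ : Representation ℂ G V) :
    ρ.IsSmooth ↔ ∀ v, ρ.IsSmoothVector v := by
  let _ : TopologicalSpace V := ⊥
  have : DiscreteTopology V := ⟨rfl⟩
  constructor
  · intro h v
    have h1 : Continuous fun g : G => ρ g v :=
      Continuous.comp (g := fun p : G × V => ρ p.1 p.2) h (by fun_prop : Continuous fun g : G => (g, v))
    exact (isOpen_discrete ({v} : Set V)).preimage h1
  · intro h
    change Continuous fun p : G × V => ρ p.1 p.2
    rw [continuous_prod_of_discrete_right]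
    intro v
    rw [continuous_discrete_rng]
    intro w
    rw [isOpen_iff_mem_nhds]
    intro g hg
    have h2 : IsOpen ((fun x : G => g⁻¹ * x) ⁻¹' {x : G | ρ x v = v}) :=
      (h v).preimage (continuous_const_mul g⁻¹)
    refine Filter.mem_of_superset (h2.mem_nhds (by simp)) ?_
    intro x hx
    simp only [Set.mem_preimage, Set.mem_ofPred_eq, Set.mem_singleton_iff] at hx hg ⊢
    rw [← hg]
    have := congrArg (ρ g) hx
    simpa [← Module.End.mul_apply, ← map_mul] using this

/-- The subspace of vectors of `ρ` fixed by the subgroup `K`. -/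
def fixedSubspace (ρ : Representation ℂ G V) (K : Subgroup G) : Submodule ℂ V where
  carrier := {v | ∀ k ∈ K, ρ k v = v}
  add_mem' hv hw k hk := by rw [map_add, hv k hk, hw k hk]
  zero_mem' k _ := map_zero (ρ k)
  smul_mem' c v hv k hk := by rw [map_smul, hv k hk]

/-- A smooth representation is admissible if the vectors fixed by any compact open subgroup form a
finite-dimensional subspace. -/
def IsAdmissible [TopologicalSpace G] (ρ : Representation ℂ G V) : Prop :=
  ρ.IsSmooth ∧ ∀ K : OpenSubgroup G, IsCompact (K : Set G) →
    FiniteDimensional ℂ (ρ.fixedSubspace (K : Subgroup G))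

end Representation

section

variable (G : Type u) [Group G] [TopologicalSpace G]

/-- The category `R(G)` of smooth complex representations of `G`. -/
abbrev SmoothRep : Type (u + 1) :=
  ObjectProperty.FullSubcategory fun V : Rep.{u} ℂ G => V.ρ.IsSmooth

/-- The full subcategory of `R(G)` of irreducible smooth representations. Since an irreducible
representation is a quotient of the group algebra, each one is isomorphic to one in this
universe. -/
abbrev IrrSmoothRep : Type (u + 1) :=
  ObjectProperty.FullSubcategory fun V : SmoothRep G => V.obj.ρ.IsIrreducible

/-- A group is tame if all of its irreducible smooth representations are admissible. -/
def IsTame : Prop :=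
  ∀ π : IrrSmoothRep G, π.obj.obj.ρ.IsAdmissible

/-- The smooth dual space: isomorphism classes of irreducible smooth representations. -/
def SmoothDual : Type (u + 1) :=
  Quotient (isIsomorphicSetoid (IrrSmoothRep G))

end

section

variable {G : Type u} [Group G] [TopologicalSpace G]

namespace IrrSmoothRep

/-- The underlying vector space of an irreducible smooth representation. -/
abbrev Space (π : IrrSmoothRep G) : Type u := π.obj.obj.V

/-- The action of `G` on the underlying vector space. -/
abbrev act (π : IrrSmoothRep G) : Representation ℂ G π.Space := π.obj.obj.ρ

/-- The point of the smooth dual space given by an irreducible smooth representation. -/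
def toDual (π : IrrSmoothRep G) : SmoothDual G :=
  Quotient.mk (isIsomorphicSetoid (IrrSmoothRep G)) π

end IrrSmoothRep

/-- The basic Fell neighbourhood `U(π, v_j, ξ_j, B, ε)`: the classes of those `σ` which have
vectors `w_j` and smooth functionals `ζ_j` whose matrix coefficients `⟨ζ_j, σ(g) w_j⟩` are
`ε`-close to `⟨ξ_j, π(g) v_j⟩` for all `g ∈ B` and all `j`. -/
def fellNhd (π : IrrSmoothRep G) {n : ℕ} (v : Fin n → π.Space)
    (ξ : Fin n → Module.Dual ℂ π.Space) (B : Set G) (ε : ℝ) : Set (SmoothDual G) :=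
  {x | ∃ σ : IrrSmoothRep G, σ.toDual = x ∧
    ∃ (w : Fin n → σ.Space) (ζ : Fin n → Module.Dual ℂ σ.Space),
      (∀ j, σ.act.dual.IsSmoothVector (ζ j)) ∧
      ∀ j, ∀ g ∈ B, ‖ξ j (π.act g (v j)) - ζ j (σ.act g (w j))‖ < ε}

/-- The Fell topology on the smooth dual space: a set is open if with each class `[π]` it contains
some `U(π, v_j, ξ_j, B, ε)`, where the `v_j` are finitely many vectors of `π`, the `ξ_j` are
vectors of the smooth dual of `π`, `B` is compact and `ε > 0`. -/
instance SmoothDual.fellTopology : TopologicalSpace (SmoothDual G) where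
  IsOpen S := ∀ π : IrrSmoothRep G, π.toDual ∈ S →
    ∃ (n : ℕ) (v : Fin n → π.Space) (ξ : Fin n → Module.Dual ℂ π.Space) (B : Set G) (ε : ℝ),
      (∀ j, π.act.dual.IsSmoothVector (ξ j)) ∧ IsCompact B ∧ 0 < ε ∧ fellNhd π v ξ B ε ⊆ S
  isOpen_univ π _ := ⟨0, Fin.elim0, Fin.elim0, ∅, 1, fun j => j.elim0, isCompact_empty,
    one_pos, Set.subset_univ _⟩
  isOpen_inter S T hS hT π hπ := by
    obtain ⟨n, v, ξ, B, ε, hξ, hB, hε, h⟩ := hS π hπ.1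
    obtain ⟨n', v', ξ', B', ε', hξ', hB', hε', h'⟩ := hT π hπ.2
    refine ⟨n + n', Fin.append v v', Fin.append ξ ξ', B ∪ B', min ε ε', ?_, hB.union hB',
      lt_min hε hε', ?_⟩
    · intro j
      refine Fin.addCases (fun i => ?_) (fun i => ?_) j
      · simpa using hξ i
      · simpa using hξ' i
    · rintro x ⟨σ, rfl, w, ζ, hζ, hc⟩
      refine ⟨h ⟨σ, rfl, fun i => w (Fin.castAdd n' i), fun i => ζ (Fin.castAdd n' i),
        fun i => hζ _, fun i g hg => ?_⟩, h' ⟨σ, rfl, fun i => w (Fin.natAdd n i),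
        fun i => ζ (Fin.natAdd n i), fun i => hζ _, fun i g hg => ?_⟩⟩
      · have := hc (Fin.castAdd n' i) g (Or.inl hg)
        simp only [Fin.append_left] at this
        exact this.trans_le (min_le_left _ _)
      · have := hc (Fin.natAdd n i) g (Or.inr hg)
        simp only [Fin.append_right] at this
        exact this.trans_le (min_le_right _ _)
  isOpen_sUnion 𝒮 h𝒮 π hπ := by
    obtain ⟨S, hS, hπS⟩ := hπ
    obtain ⟨n, v, ξ, B, ε, hξ, hB, hε, h⟩ := h𝒮 S hS π hπS
    exact ⟨n, v, ξ, B, ε, hξ, hB, hε, h.trans (Set.subset_sUnion_of_mem hS)⟩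

end

/-! A nonzero vector of an irreducible representation is studied through its relations over `ℂ[G]`;
Haar averaging makes smooth representations completely reducible over compact subgroups.

Projective implies open: let `v ≠ 0` in `π` be fixed by a compact open `K`. The universal
representation on a `K`-fixed vector, a quotient of `ℂ[G]`, maps onto `π`. A section sends `v` to
the class of some `f`, so `f v = v`, and every `K`-fixed `w₀` in an irreducible `σ` with `f w₀ ≠ 0`
yields a nonzero map `π → σ`, an isomorphism. If one matrix coefficient of `σ` is close to one of
`π` on `supp f · K`, such a `w₀` exists (`exists_fixed_asAlgebraHom_ne_zero`).

Open implies projective: by admissibility, the relations of `v₀ ≠ 0` over some compact open `M`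
determine it in `π` up to scalars (`IsAdmissible.exists_typeSubspace_le_span`). An irreducible `σ`
with a nonzero vector satisfying these relations reproduces the coefficients of `π` on `M` exactly
(`exists_matrix_coefficient_eq`), so for `M` large, openness gives `σ ≅ π`. It follows that in every
smooth representation the `ℂ[M]`-relations of `v₀` imply all its `ℂ[G]`-relations
(`asAlgebraHom_eq_zero_of_mem_typeSubspace`). Lifting `v₀` through an epimorphism is thus a problem
over `M`, solved by complete reducibility. -/

/-! ### Averaging over compact groups -/

section Average

/-- A compact group carries a normalized left invariant mean on its locally constant functions. -/
theorem exists_invariant_mean (K : Type*) [Group K] [TopologicalSpace K] [IsTopologicalGroup K]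
    [CompactSpace K] :
    ∃ I : LocallyConstant K ℂ →ₗ[ℂ] ℂ, (∀ c : ℂ, I (LocallyConstant.const K c) = c) ∧
      (∀ (h : K) (f f' : LocallyConstant K ℂ), (∀ k, f' k = f (h * k)) → I f' = I f) ∧
      ∀ (f : LocallyConstant K ℂ) (C : ℝ), (∀ k, ‖f k‖ ≤ C) → ‖I f‖ ≤ C := by
  let _ : MeasurableSpace K := borel K
  have : BorelSpace K := ⟨rfl⟩
  let μ : MeasureTheory.Measure K := MeasureTheory.Measure.haarMeasure ⊤
  have hμ : MeasureTheory.IsProbabilityMeasure μ :=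
    ⟨by simpa using MeasureTheory.Measure.haarMeasure_self (K₀ := (⊤ : TopologicalSpace.PositiveCompacts K))⟩
  have hint (f : LocallyConstant K ℂ) : MeasureTheory.Integrable f μ :=
    f.continuous.integrable_of_hasCompactSupport (HasCompactSupport.of_compactSpace _)
  refine ⟨{ toFun := fun f => ∫ k, f k ∂μ
            map_add' := fun f g => MeasureTheory.integral_add (hint f) (hint g)
            map_smul' := fun c f => MeasureTheory.integral_const_mul c f },
    fun c => ?_, fun h f f' hf => ?_, fun f C hC => ?_⟩
  · change ∫ _, c ∂μ = c
    simp
  · change ∫ k, f' k ∂μ = ∫ k, f k ∂μ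
    simp only [hf]
    exact MeasureTheory.integral_mul_left_eq_self _ h
  · change ‖∫ k, f k ∂μ‖ ≤ C
    simpa using MeasureTheory.norm_integral_le_of_norm_le_const (μ := μ) (.of_forall hC)

variable {K : Type*} [TopologicalSpace K] [CompactSpace K]
  {X : Type*} [AddCommGroup X] [Module ℂ X]

theorem eq_of_forall_dual {x y : X} (h : ∀ l : Module.Dual ℂ X, l x = l y) : x = y := by
  rw [← sub_eq_zero, ← Module.forall_dual_apply_eq_zero_iff ℂ]
  intro l
  rw [map_sub, h, sub_self]

/-- A scalar mean extends to locally constant functions with values in a vector space. -/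
theorem exists_vector_mean (I : LocallyConstant K ℂ →ₗ[ℂ] ℂ) (f : LocallyConstant K X) :
    ∃ y : X, ∀ l : Module.Dual ℂ X, l y = I (f.map l) := by
  classical
  have hfin := f.range_finite
  have hc (y : X) : IsClopen (f ⁻¹' {y}) := f.isLocallyConstant.isClopen_fiber y
  -- By compactness `f` takes finitely many values; each is weighted by the mean of its fibre.
  refine ⟨∑ y ∈ hfin.toFinset, I (LocallyConstant.charFn ℂ (hc y)) • y, fun l => ?_⟩
  have : f.map l = ∑ y ∈ hfin.toFinset, l y • LocallyConstant.charFn ℂ (hc y) := by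
    ext k
    have h1 : (∑ y ∈ hfin.toFinset, l y • LocallyConstant.charFn ℂ (hc y)) k =
        ∑ y ∈ hfin.toFinset, (l y • LocallyConstant.charFn ℂ (hc y)) k := by
      exact map_sum (LocallyConstant.evalAddMonoidHom k : LocallyConstant K ℂ →+ ℂ) _ _
    rw [h1, Finset.sum_eq_single (f k)]
    · simp [LocallyConstant.charFn, Set.indicator]
    · intro b _ hb
      simp [LocallyConstant.charFn, Set.indicator, hb.symm]
    · intro h
      exact absurd (hfin.mem_toFinset.mpr ⟨k, rfl⟩) h
  rw [this]
  simp [mul_comm]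

end Average

namespace Representation

variable {G : Type u} [Group G] [TopologicalSpace G]
  {X : Type*} [AddCommGroup X] [Module ℂ X]

theorem IsSmooth.isLocallyConstant {ρ : Representation ℂ G X} (hρ : ρ.IsSmooth) (x : X) :
    IsLocallyConstant fun g : G => ρ g x := by
  let _ : TopologicalSpace X := ⊥
  have : DiscreteTopology X := ⟨rfl⟩
  have h1 : Continuous fun g : G => ρ g x :=
    Continuous.comp (g := fun p : G × X => ρ p.1 p.2) hρ
      (by fun_prop : Continuous fun g : G => (g, x))
  exact (IsLocallyConstant.iff_continuous _).mpr h1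

variable [IsTopologicalGroup G]

/-- A vector of a smooth representation can be averaged over a compact subgroup. -/
theorem IsSmooth.exists_average {ρ : Representation ℂ G X} (hρ : ρ.IsSmooth) (K : Subgroup G)
    (hK : IsCompact (K : Set G)) (x : X) :
    ∃ y : X, (∀ k ∈ K, ρ k y = y) ∧ ∀ (l : Module.Dual ℂ X) (c : ℂ) (C : ℝ),
      (∀ k ∈ K, ‖c - l (ρ k x)‖ ≤ C) → ‖c - l y‖ ≤ C := by
  have : CompactSpace K := isCompact_iff_compactSpace.mp hK
  obtain ⟨I, hI1, hIinv, hIle⟩ := exists_invariant_mean K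
  let f : LocallyConstant K X := ⟨fun k => ρ k x,
    (hρ.isLocallyConstant x).comp_continuous continuous_subtype_val⟩
  obtain ⟨y, hy⟩ := exists_vector_mean I f
  refine ⟨y, fun k hk => eq_of_forall_dual fun l => ?_, fun l c C h => ?_⟩
  · have := hy (l ∘ₗ ρ k)
    rw [LinearMap.comp_apply] at this
    rw [this, hy l]
    refine hIinv ⟨k, hk⟩ _ _ fun k' => ?_
    simp [f]
  -- `c - l y` is the mean of `k ↦ c - l (ρ k x)`, so it inherits any uniform bound.
  · rw [hy l, ← hI1 c, ← map_sub]
    exact hIle _ _ fun k => h k k.2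

/-- Complete reducibility of smooth representations restricted to a compact subgroup. -/
theorem IsSmooth.exists_equivariant_projection {ρ : Representation ℂ G X} (hρ : ρ.IsSmooth)
    (K : Subgroup G) (hK : IsCompact (K : Set G)) (S : Submodule ℂ X)
    (hS : ∀ k ∈ K, ∀ s ∈ S, ρ k s ∈ S) :
    ∃ p : X →ₗ[ℂ] X, (∀ x, p x ∈ S) ∧ (∀ s ∈ S, p s = s) ∧
      ∀ k ∈ K, ∀ x, p (ρ k x) = ρ k (p x) := by
  have : CompactSpace K := isCompact_iff_compactSpace.mp hK
  obtain ⟨I, hI1, hIinv, -⟩ := exists_invariant_mean K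
  obtain ⟨q, hq⟩ := S.exists_isCompl
  -- An arbitrary linear projection onto `S`; the mean of its conjugates by `K` becomes equivariant.
  let p₀ : X →ₗ[ℂ] X := S.subtype ∘ₗ S.projectionOnto q hq
  have hp₀ (x : X) : p₀ x ∈ S := by simp [p₀]
  have hp₀' (s : X) (hs : s ∈ S) : p₀ s = s := by
    exact congrArg Subtype.val (Submodule.projectionOnto_apply_left hq ⟨s, hs⟩)
  have hlc (x : X) : IsLocallyConstant fun k : K => ρ k (p₀ (ρ (k : G)⁻¹ x)) := by
    let _ : TopologicalSpace X := ⊥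
    have : DiscreteTopology X := ⟨rfl⟩
    rw [IsLocallyConstant.iff_continuous]
    have h1 : Continuous fun k : K => ρ (k : G)⁻¹ x :=
      ((IsLocallyConstant.iff_continuous _).mp (hρ.isLocallyConstant x)).comp
        (continuous_inv.comp continuous_subtype_val)
    have h2 : Continuous fun k : K => p₀ (ρ (k : G)⁻¹ x) :=
      (continuous_of_discreteTopology (f := p₀)).comp h1
    exact Continuous.comp (g := fun p : G × X => ρ p.1 p.2) hρ
      (continuous_subtype_val.prodMk h2)
  let F (x : X) : LocallyConstant K X := ⟨_, hlc x⟩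
  obtain ⟨p, hp⟩ : ∃ p : X →ₗ[ℂ] X, ∀ (x : X) (l : Module.Dual ℂ X), l (p x) = I ((F x).map l) := by
    choose p hp using fun x => exists_vector_mean I (F x)
    refine ⟨{ toFun := p, map_add' := fun x y => eq_of_forall_dual fun l => ?_,
              map_smul' := fun c x => eq_of_forall_dual fun l => ?_ }, hp⟩
    · rw [map_add, hp, hp, hp, ← map_add]
      congr 1
      ext k
      change l (ρ k (p₀ (ρ (k : G)⁻¹ (x + y)))) =
        l (ρ k (p₀ (ρ (k : G)⁻¹ x))) + l (ρ k (p₀ (ρ (k : G)⁻¹ y)))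
      simp only [map_add]
    · rw [RingHom.id_apply, map_smul, hp, hp, ← map_smul]
      congr 1
      ext k
      change l (ρ k (p₀ (ρ (k : G)⁻¹ (c • x)))) = c • l (ρ k (p₀ (ρ (k : G)⁻¹ x)))
      simp only [map_smul]
  refine ⟨p, fun x => ?_, fun s hs => eq_of_forall_dual fun l => ?_,
    fun k hk x => eq_of_forall_dual fun l => ?_⟩
  · by_contra hx
    -- A functional vanishing on `S` but not at `p x` would see the mean of the zero function.
    obtain ⟨l, hl, hlS⟩ := Submodule.exists_le_ker_of_notMem hx
    refine hl ?_
    have : (F x).map l = 0 := by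
      ext k
      exact hlS (hS k k.2 _ (hp₀ _))
    rw [hp, this, map_zero]
  · rw [hp, ← hI1 (l s)]
    congr 1
    ext k
    change l (ρ k (p₀ (ρ (k : G)⁻¹ s))) = l s
    rw [hp₀' _ (hS _ (K.inv_mem k.2) s hs), self_inv_apply]
  · have := hp x (l ∘ₗ ρ k)
    rw [LinearMap.comp_apply] at this
    rw [this, hp]
    refine (hIinv ⟨k, hk⟩ _ _ fun k' => ?_).symm
    change l (ρ k (ρ k' (p₀ (ρ (k' : G)⁻¹ x)))) =
      l (ρ (k * k') (p₀ (ρ (k * k' : G)⁻¹ (ρ k x))))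
    rw [mul_inv_rev, map_mul, map_mul, Module.End.mul_apply, Module.End.mul_apply, inv_self_apply]

end Representation

/-! ### Group algebras of subgroups, and exhaustion by compact open subgroups -/

/-- The group algebra of a subgroup, as a subalgebra of the group algebra. -/
noncomputable def subgroupAlgebra {G : Type*} [Group G] (M : Subgroup G) :
    Subalgebra ℂ (MonoidAlgebra ℂ G) :=
  Algebra.adjoin ℂ (MonoidAlgebra.of ℂ G '' M)

section SubgroupAlgebra

variable {G : Type u} [Group G]

theorem of_mem_subgroupAlgebra {M : Subgroup G} {m : G} (hm : m ∈ M) :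
    MonoidAlgebra.of ℂ G m ∈ subgroupAlgebra M :=
  Algebra.subset_adjoin ⟨m, hm, rfl⟩

theorem subgroupAlgebra_mono {M N : Subgroup G} (h : M ≤ N) :
    subgroupAlgebra M ≤ subgroupAlgebra N :=
  Algebra.adjoin_mono (Set.image_mono h)

theorem mem_subgroupAlgebra_top (a : MonoidAlgebra ℂ G) : a ∈ subgroupAlgebra (⊤ : Subgroup G) := by
  induction a using MonoidAlgebra.induction_on with
  | of m => exact of_mem_subgroupAlgebra trivial
  | add x y hx hy => exact add_mem hx hy
  | smul r x hx => exact Subalgebra.smul_mem _ hx r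

/-- An element of `ℂ[G]` has finite support, so directedness places it over one compact open
subgroup; this reduces relations over `ℂ[G]` to compact groups. -/
theorem exists_le_mem_subgroupAlgebra [TopologicalSpace G] [IsEllCGroup G]
    (M : OpenSubgroup G) (hM : IsCompact (M : Set G)) (a : MonoidAlgebra ℂ G) :
    ∃ N : OpenSubgroup G, IsCompact (N : Set G) ∧ M ≤ N ∧ a ∈ subgroupAlgebra (N : Subgroup G) := by
  induction a using MonoidAlgebra.induction_on with
  | of m =>
    obtain ⟨L, hL, hmL⟩ := IsEllCGroup.exists_mem_compact_open m
    obtain ⟨N, hN, hMN, hLN⟩ := IsEllCGroup.directed_compact_open M L hM hL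
    exact ⟨N, hN, hMN, of_mem_subgroupAlgebra (hLN hmL)⟩
  | add x y hx hy =>
    obtain ⟨N₁, hN₁, hM₁, h₁⟩ := hx
    obtain ⟨N₂, hN₂, hM₂, h₂⟩ := hy
    obtain ⟨N, hN, h1N, h2N⟩ := IsEllCGroup.directed_compact_open N₁ N₂ hN₁ hN₂
    exact ⟨N, hN, hM₁.trans h1N, add_mem (subgroupAlgebra_mono h1N h₁) (subgroupAlgebra_mono h2N h₂)⟩
  | smul r x hx =>
    obtain ⟨N, hN, hMN, h⟩ := hx
    exact ⟨N, hN, hMN, Subalgebra.smul_mem _ h r⟩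

theorem exists_compact_open_superset [TopologicalSpace G] [IsEllCGroup G] {B : Set G}
    (hB : IsCompact B) : ∃ M : OpenSubgroup G, IsCompact (M : Set G) ∧ B ⊆ M := by
  let ι := {M : OpenSubgroup G // IsCompact (M : Set G)}
  obtain ⟨M₀, hM₀, -⟩ := IsEllCGroup.exists_mem_compact_open (1 : G)
  have : Nonempty ι := ⟨⟨M₀, hM₀⟩⟩
  obtain ⟨M, hM⟩ := hB.elim_directed_cover (fun M : ι => (M.1 : Set G)) (fun M => M.1.isOpen)
    (fun g _ => by
      obtain ⟨K, hK, hg⟩ := IsEllCGroup.exists_mem_compact_open g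
      exact Set.mem_iUnion.mpr ⟨⟨K, hK⟩, hg⟩)
    (fun K L => by
      obtain ⟨M, hM, hKM, hLM⟩ := IsEllCGroup.directed_compact_open K.1 L.1 K.2 L.2
      exact ⟨⟨M, hM⟩, hKM, hLM⟩)
  exact ⟨M.1, M.2, hM⟩

end SubgroupAlgebra

/-- A linear map vanishing on the kernel of another one factors through it. -/
theorem LinearMap.exists_comp_eq_of_ker_le {k A V W : Type*} [Field k] [AddCommGroup A] [Module k A]
    [AddCommGroup V] [Module k V] [AddCommGroup W] [Module k W] (f : A →ₗ[k] V) (g : A →ₗ[k] W)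
    (h : ∀ a, f a = 0 → g a = 0) : ∃ l : V →ₗ[k] W, ∀ a, l (f a) = g a := by
  obtain ⟨l, hl⟩ := LinearMap.exists_extend
    (((LinearMap.ker f).liftQ g fun a ha => h a ha) ∘ₗ f.quotKerEquivRange.symm.toLinearMap)
  refine ⟨l, fun a => ?_⟩
  have h1 := LinearMap.congr_fun hl ⟨f a, a, rfl⟩
  have h2 : f.quotKerEquivRange.symm ⟨f a, a, rfl⟩ = (LinearMap.ker f).mkQ a :=
    f.quotKerEquivRange_symm_apply_image a ⟨a, rfl⟩
  simpa [h2] using! h1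

/-! ### Cyclic modules over the group algebra, and smoothness -/

namespace Representation

section Algebraic

variable {G : Type u} [Group G]
  {X : Type*} [AddCommGroup X] [Module ℂ X] {Y : Type*} [AddCommGroup Y] [Module ℂ Y]
  {ρ : Representation ℂ G X} {σ : Representation ℂ G Y}

theorem map_asAlgebraHom_of_mem {M : Subgroup G} {p : X →ₗ[ℂ] Y}
    (hp : ∀ m ∈ M, ∀ x, p (ρ m x) = σ m (p x)) {a : MonoidAlgebra ℂ G}
    (ha : a ∈ subgroupAlgebra M) (x : X) :
    p (ρ.asAlgebraHom a x) = σ.asAlgebraHom a (p x) := by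
  induction ha using Algebra.adjoin_induction generalizing x with
  | mem a ha =>
    obtain ⟨m, hm, rfl⟩ := ha
    simpa using hp m hm x
  | algebraMap r => simp
  | add a b _ _ ha hb => simp [ha, hb]
  | mul a b _ _ ha hb => simp [ha, hb]

theorem IntertwiningMap.map_asAlgebraHom (f : IntertwiningMap ρ σ) (a : MonoidAlgebra ℂ G) (x : X) :
    f (ρ.asAlgebraHom a x) = σ.asAlgebraHom a (f x) :=
  map_asAlgebraHom_of_mem (p := f.toLinearMap) (ρ := ρ) (σ := σ) (M := ⊤)
    (fun m _ x => IntertwiningMap.isIntertwining _ _ f m x) (mem_subgroupAlgebra_top a) x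

variable (ρ) in
/-- The orbit map `a ↦ a • x` of the group algebra. -/
noncomputable def orbitMap (x : X) : MonoidAlgebra ℂ G →ₗ[ℂ] X :=
  LinearMap.applyₗ x ∘ₗ ρ.asAlgebraHom.toLinearMap

@[simp]
theorem orbitMap_apply (x : X) (a : MonoidAlgebra ℂ G) :
    ρ.orbitMap x a = ρ.asAlgebraHom a x := rfl

theorem IsIrreducible.exists_asAlgebraHom_eq (hρ : ρ.IsIrreducible) {v : X} (hv : v ≠ 0) (u : X) :
    ∃ a, ρ.asAlgebraHom a v = u := by
  let S : Subrepresentation ρ := ⟨LinearMap.range (ρ.orbitMap v), fun g u hu => by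
    obtain ⟨a, rfl⟩ := hu
    exact ⟨MonoidAlgebra.of ℂ G g * a, by simp⟩⟩
  have hvS : v ∈ S.toSubmodule := ⟨1, by simp⟩
  rcases IsSimpleOrder.eq_bot_or_eq_top S with h | h
  · rw [h] at hvS
    exact absurd ((Submodule.mem_bot ℂ).mp hvS) hv
  · have hu : u ∈ S.toSubmodule := by
      rw [h]
      exact Submodule.mem_top
    exact hu

/-- The map is `a v ↦ a y`, well defined because `y` satisfies the relations of `v`. -/
theorem exists_intertwiningMap {v : X} (hv : ∀ u, ∃ a, ρ.asAlgebraHom a v = u) (y : Y)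
    (h : ∀ a, ρ.asAlgebraHom a v = 0 → σ.asAlgebraHom a y = 0) :
    ∃ f : IntertwiningMap ρ σ, ∀ a, f (ρ.asAlgebraHom a v) = σ.asAlgebraHom a y := by
  obtain ⟨l, hl⟩ := (ρ.orbitMap v).exists_comp_eq_of_ker_le (σ.orbitMap y) h
  simp only [orbitMap_apply] at hl
  refine ⟨l.intertwiningMap_of_isIntertwiningMap _ _ fun g u => ?_, hl⟩
  obtain ⟨a, rfl⟩ := hv u
  have := hl (MonoidAlgebra.of ℂ G g * a)
  simpa [hl] using this

/-- The representation of `G` on the quotient of its group algebra by a left ideal. -/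
noncomputable def quotientRep (J : Ideal (MonoidAlgebra ℂ G)) :
    Representation ℂ G (MonoidAlgebra ℂ G ⧸ J) :=
  ofModule' _

@[simp]
theorem asAlgebraHom_quotientRep_mk (J : Ideal (MonoidAlgebra ℂ G)) (a b : MonoidAlgebra ℂ G) :
    (quotientRep J).asAlgebraHom a (Submodule.Quotient.mk b) = Submodule.Quotient.mk (a * b) := by
  have : (quotientRep J).asAlgebraHom = Algebra.lsmul ℂ ℂ (MonoidAlgebra ℂ G ⧸ J) :=
    (MonoidAlgebra.lift ℂ _ G).apply_symm_apply _
  rw [this]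
  rfl

theorem asAlgebraHom_quotientRep_mk_one (J : Ideal (MonoidAlgebra ℂ G)) (a : MonoidAlgebra ℂ G) :
    (quotientRep J).asAlgebraHom a (Submodule.Quotient.mk 1) = Submodule.Quotient.mk a := by
  simp

theorem exists_asAlgebraHom_quotientRep_eq (J : Ideal (MonoidAlgebra ℂ G))
    (u : MonoidAlgebra ℂ G ⧸ J) :
    ∃ a, (quotientRep J).asAlgebraHom a (Submodule.Quotient.mk 1) = u := by
  obtain ⟨a, rfl⟩ := Submodule.Quotient.mk_surjective J u
  exact ⟨a, asAlgebraHom_quotientRep_mk_one J a⟩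

theorem isIrreducible_quotientRep {J : Ideal (MonoidAlgebra ℂ G)} (hJ : J.IsMaximal) :
    (quotientRep J).IsIrreducible := by
  rw [irreducible_iff_isSimpleModule_asModule]
  have : IsSimpleModule (MonoidAlgebra ℂ G) (MonoidAlgebra ℂ G ⧸ J) :=
    isSimpleModule_iff_isCoatom.mpr hJ.out
  let e : (quotientRep J).asModule ≃ₗ[MonoidAlgebra ℂ G] MonoidAlgebra ℂ G ⧸ J :=
    { (quotientRep J).asModuleEquiv.toAddEquiv with
      map_smul' := fun a x => by
        obtain ⟨b, rfl⟩ := Submodule.Quotient.mk_surjective J x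
        exact asAlgebraHom_quotientRep_mk J a b }
  exact IsSimpleModule.congr e

end Algebraic

section Smooth

variable {G : Type u} [Group G] [TopologicalSpace G]
  {X : Type*} [AddCommGroup X] [Module ℂ X] {ρ : Representation ℂ G X}

variable (ρ) in
/-- The stabilizer of a vector. -/
def vectorStabilizer (v : X) : Subgroup G where
  carrier := {g | ρ g v = v}
  one_mem' := by simp
  mul_mem' {a b} ha hb := by
    simp only [Set.mem_ofPred_eq] at ha hb ⊢
    rw [map_mul, Module.End.mul_apply, hb, ha]
  inv_mem' {a} ha := by
    simp only [Set.mem_ofPred_eq] at ha ⊢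
    nth_rewrite 1 [← ha]
    rw [inv_self_apply]

theorem IsSmoothVector.exists_openSubgroup {v : X} (h : ρ.IsSmoothVector v) :
    ∃ U : OpenSubgroup G, ∀ g ∈ U, ρ g v = v :=
  ⟨⟨ρ.vectorStabilizer v, h⟩, fun _ hg => hg⟩

variable [IsTopologicalGroup G]

theorem isSmoothVector_of_openSubgroup {v : X} (U : OpenSubgroup G) (h : ∀ g ∈ U, ρ g v = v) :
    ρ.IsSmoothVector v :=
  Subgroup.isOpen_mono (H₁ := (U : Subgroup G)) (H₂ := ρ.vectorStabilizer v) h U.isOpen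

/-- The stabilizer of a smooth vector contains a compact open subgroup. -/
theorem IsSmooth.exists_compact_open_fixing {G : Type u} [Group G] [TopologicalSpace G]
    [IsEllCGroup G] {ρ : Representation ℂ G X} (hρ : ρ.IsSmooth) (v : X) :
    ∃ K : OpenSubgroup G, IsCompact (K : Set G) ∧ ∀ k ∈ K, ρ k v = v := by
  obtain ⟨U, hU⟩ := ((isSmooth_iff ρ).mp hρ v).exists_openSubgroup
  obtain ⟨M, hM, -⟩ := IsEllCGroup.exists_mem_compact_open (1 : G)
  refine ⟨M ⊓ U, ?_, fun k hk => hU k (OpenSubgroup.mem_inf.mp hk).2⟩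
  exact hM.inter_right U.isClosed

/-- A representation generated by a smooth vector is smooth. -/
theorem isSmooth_of_generator {v : X} (hv : ∀ u, ∃ a, ρ.asAlgebraHom a v = u)
    (U : OpenSubgroup G) (hU : ∀ g ∈ U, ρ g v = v) : ρ.IsSmooth := by
  rw [isSmooth_iff]
  intro u
  obtain ⟨a, rfl⟩ := hv u
  suffices ∃ U : OpenSubgroup G, ∀ g ∈ U, ρ g (ρ.asAlgebraHom a v) = ρ.asAlgebraHom a v by
    obtain ⟨U, hU⟩ := this
    exact isSmoothVector_of_openSubgroup U hU
  induction a using MonoidAlgebra.induction_on with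
  | of m =>
    -- The conjugate `m U m⁻¹` fixes `m v`.
    refine ⟨U.comap (MulAut.conj m⁻¹).toMonoidHom (by
      change Continuous fun x => m⁻¹ * x * m⁻¹⁻¹
      fun_prop), fun g hg => ?_⟩
    have := hU _ (OpenSubgroup.mem_comap.mp hg)
    simp only [MulEquiv.coe_toMonoidHom, MulAut.conj_apply, inv_inv, map_mul,
      Module.End.mul_apply] at this
    rw [asAlgebraHom_of]
    nth_rewrite 2 [← this]
    rw [self_inv_apply]
  | add x y hx hy =>
    obtain ⟨V, hV⟩ := hx
    obtain ⟨W, hW⟩ := hy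
    refine ⟨V ⊓ W, fun g hg => ?_⟩
    obtain ⟨h1, h2⟩ := OpenSubgroup.mem_inf.mp hg
    simp [hV g h1, hW g h2]
  | smul r x hx =>
    obtain ⟨V, hV⟩ := hx
    exact ⟨V, fun g hg => by simp [hV g hg]⟩

end Smooth

end Representation

/-! ### Vectors of a given type over a compact open subgroup -/

namespace Representation

section TypeSubspace

variable {G : Type u} [Group G]
  {X : Type*} [AddCommGroup X] [Module ℂ X] {Y : Type*} [AddCommGroup Y] [Module ℂ Y]
  {Z : Type*} [AddCommGroup Z] [Module ℂ Z]

/-- The vectors `y` of `σ` which satisfy all the relations over the group algebra of `M` that the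
vector `v` of `ρ` satisfies. -/
def typeSubspace (ρ : Representation ℂ G X) (v : X) (M : Subgroup G) (σ : Representation ℂ G Y) :
    Submodule ℂ Y where
  carrier := {y | ∀ a ∈ subgroupAlgebra M, ρ.asAlgebraHom a v = 0 → σ.asAlgebraHom a y = 0}
  add_mem' hx hy a ha h := by rw [map_add, hx a ha h, hy a ha h, add_zero]
  zero_mem' a _ _ := map_zero _
  smul_mem' c y hy a ha h := by rw [map_smul, hy a ha h, smul_zero]

variable {ρ : Representation ℂ G X} {v : X} {σ : Representation ℂ G Y} {τ : Representation ℂ G Z}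

theorem typeSubspace_anti {M N : Subgroup G} (h : M ≤ N) :
    typeSubspace ρ v N σ ≤ typeSubspace ρ v M σ :=
  fun _ hy a ha => hy a (subgroupAlgebra_mono h ha)

theorem map_mem_typeSubspace {M : Subgroup G} {p : Y →ₗ[ℂ] Z}
    (hp : ∀ m ∈ M, ∀ y, p (σ m y) = τ m (p y)) {y : Y} (hy : y ∈ typeSubspace ρ v M σ) :
    p y ∈ typeSubspace ρ v M τ := fun a ha h => by
  rw [← map_asAlgebraHom_of_mem hp ha, hy a ha h, map_zero]

/-- Being fixed by `k` is the relation `k - 1`. With admissibility this makes type subspaces of `ρ`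
finite-dimensional. -/
theorem typeSubspace_le_fixedSubspace {K M : Subgroup G} (hKM : K ≤ M)
    (hv : ∀ k ∈ K, ρ k v = v) : typeSubspace ρ v M σ ≤ σ.fixedSubspace K := by
  intro y hy k hk
  have := hy (MonoidAlgebra.of ℂ G k - 1)
    (sub_mem (of_mem_subgroupAlgebra (hKM hk)) (one_mem _)) (by simp [hv k hk])
  simpa [sub_eq_zero] using this

/-- Schur's lemma for irreducible representations with a finite-dimensional nonzero space of vectors
fixed by some subgroup. -/
theorem IsIrreducible.exists_eq_smul (hρ : ρ.IsIrreducible) (K : Subgroup G)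
    [FiniteDimensional ℂ (ρ.fixedSubspace K)] (hv0 : v ≠ 0) (hv : v ∈ ρ.fixedSubspace K) {u : X}
    (hu : ∀ a, ρ.asAlgebraHom a v = 0 → ρ.asAlgebraHom a u = 0) : ∃ c : ℂ, u = c • v := by
  obtain ⟨f, hf⟩ := exists_intertwiningMap (hρ.exists_asAlgebraHom_eq hv0) u hu
  have hfv : f v = u := by simpa using hf 1
  have hfK : ∀ x ∈ ρ.fixedSubspace K, f.toLinearMap x ∈ ρ.fixedSubspace K := fun x hx k hk => by
    have := IntertwiningMap.isIntertwining _ _ f k x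
    rw [hx k hk] at this
    exact this.symm
  have : Nontrivial (ρ.fixedSubspace K) := ⟨⟨⟨v, hv⟩, 0, by simpa [Subtype.ext_iff] using hv0⟩⟩
  -- The endomorphism `v ↦ u` preserves the finite-dimensional fixed space, hence has an eigenvector
  -- there; this generates `X`, so the endomorphism is a scalar.
  obtain ⟨c, hc⟩ := Module.End.exists_eigenvalue (f.toLinearMap.restrict hfK)
  obtain ⟨e, he⟩ := hc.exists_hasEigenvector
  have he1 : f e.1 = c • e.1 := congrArg Subtype.val he.apply_eq_smul
  obtain ⟨a, ha⟩ := hρ.exists_asAlgebraHom_eq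
    (fun h => he.2 (Subtype.ext h) : e.1 ≠ 0) v
  refine ⟨c, ?_⟩
  rw [← hfv, ← ha, IntertwiningMap.map_asAlgebraHom, he1, map_smul]

end TypeSubspace

section Smooth

variable {G : Type u} [Group G] [TopologicalSpace G] [IsEllCGroup G]
  {X : Type*} [AddCommGroup X] [Module ℂ X] {Y : Type*} [AddCommGroup Y] [Module ℂ Y]
  {ρ : Representation ℂ G X} {v : X} {σ : Representation ℂ G Y}

/-- In an irreducible admissible representation a nonzero vector is determined up to scalars by its
relations over the group algebra of a large enough compact open subgroup. -/
theorem IsAdmissible.exists_typeSubspace_le_span (hρ : ρ.IsAdmissible) (hirr : ρ.IsIrreducible)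
    (hv : v ≠ 0) : ∃ M : OpenSubgroup G, IsCompact (M : Set G) ∧
      ∀ u ∈ typeSubspace ρ v (M : Subgroup G) ρ, ∃ c : ℂ, u = c • v := by
  obtain ⟨K, hK, hKv⟩ := hρ.1.exists_compact_open_fixing v
  have hfin := hρ.2 K hK
  let ι := {M : OpenSubgroup G // IsCompact (M : Set G) ∧ K ≤ M}
  let d (M : ι) : ℕ := Module.finrank ℂ (typeSubspace ρ v (M.1 : Subgroup G) ρ)
  have : Nonempty ι := ⟨⟨K, hK, le_rfl⟩⟩
  -- Type subspaces shrink as `M` grows. Past the minimal dimension they are constant, so their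
  -- vectors satisfy all relations of `v` over `ℂ[G]`, and Schur's lemma applies.
  obtain ⟨M, hM⟩ : ∃ M : ι, ∀ N, d M ≤ d N :=
    ⟨Function.argmin d, fun N => Function.argmin_le d N⟩
  refine ⟨M.1, M.2.1, fun u hu => ?_⟩
  refine hirr.exists_eq_smul (K : Subgroup G) hv hKv fun a ha => ?_
  obtain ⟨N, hN, hMN, haN⟩ := exists_le_mem_subgroupAlgebra M.1 M.2.1 a
  have hle : typeSubspace ρ v (N : Subgroup G) ρ ≤ typeSubspace ρ v (M.1 : Subgroup G) ρ :=
    typeSubspace_anti hMN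
  have : FiniteDimensional ℂ (typeSubspace ρ v (M.1 : Subgroup G) ρ) :=
    Submodule.finiteDimensional_of_le (typeSubspace_le_fixedSubspace M.2.2 hKv)
  have heq := Submodule.eq_of_le_of_finrank_le hle (hM ⟨N, hN, M.2.2.trans hMN⟩)
  rw [← heq] at hu
  exact hu a haN ha

/-- The matrix coefficients of `ρ` on a compact open subgroup `M` generated by `v` also occur in
every smooth representation containing the `M`-type of `v`. -/
theorem exists_matrix_coefficient_eq (hρ : ρ.IsSmooth) (hσ : σ.IsSmooth) (M : OpenSubgroup G)
    (hM : IsCompact (M : Set G))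
    (hline : ∀ u ∈ typeSubspace ρ v (M : Subgroup G) ρ, ∃ c : ℂ, u = c • v)
    {w : Y} (hw0 : w ≠ 0) (hw : w ∈ typeSubspace ρ v (M : Subgroup G) σ)
    {ξ : Module.Dual ℂ X} (hξ : ρ.dual.IsSmoothVector ξ) :
    ∃ ζ : Module.Dual ℂ Y, σ.dual.IsSmoothVector ζ ∧
      ∀ a ∈ subgroupAlgebra (M : Subgroup G), ζ (σ.asAlgebraHom a w) = ξ (ρ.asAlgebraHom a v) := by
  have hmul {m : G} (hm : m ∈ (M : Subgroup G)) {a : MonoidAlgebra ℂ G}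
      (ha : a ∈ subgroupAlgebra (M : Subgroup G)) :
      MonoidAlgebra.of ℂ G m * a ∈ subgroupAlgebra (M : Subgroup G) :=
    mul_mem (of_mem_subgroupAlgebra hm) ha
  have hker : ∀ a ∈ subgroupAlgebra (M : Subgroup G), σ.asAlgebraHom a w = 0 →
      ρ.asAlgebraHom a v = 0 := by
    -- `D` is the obstruction to `a w ↦ a v` being well defined on `ℂ[M] w`. The projection of `v`
    -- to `D` is a multiple of `v`; were it nonzero, `v = b v` with `b w = 0`, and the relation `1 -
    -- b` would give `w = 0`.
    let D : Submodule ℂ X := Submodule.map (ρ.orbitMap v)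
      ((subgroupAlgebra (M : Subgroup G)).toSubmodule ⊓ LinearMap.ker (σ.orbitMap w))
    obtain ⟨p, hpD, hpid, hp⟩ := hρ.exists_equivariant_projection (M : Subgroup G) hM D (by
      rintro m hm _ ⟨a, ⟨ha, haw⟩, rfl⟩
      refine ⟨MonoidAlgebra.of ℂ G m * a, ⟨hmul hm ha, ?_⟩, by simp⟩
      have haw' : σ.asAlgebraHom a w = 0 := haw
      simp [haw'])
    have hpv : p v = 0 := by
      obtain ⟨c, hc⟩ := hline _ (map_mem_typeSubspace (p := p) hp
        (show v ∈ typeSubspace ρ v (M : Subgroup G) ρ from fun _ _ h => h))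
      by_contra hne
      have hc0 : c ≠ 0 := by
        rintro rfl
        exact hne (by rw [hc, zero_smul])
      have hvD : v ∈ D := (D.smul_mem_iff hc0).mp (hc ▸ hpD v)
      obtain ⟨b, ⟨hb, hbw⟩, hbv⟩ := hvD
      have hbw' : σ.asAlgebraHom b w = 0 := hbw
      have hbv' : ρ.asAlgebraHom b v = v := hbv
      have := hw (1 - b) (sub_mem (one_mem _) hb) (by simp [hbv'])
      simp [hbw'] at this
      exact hw0 this
    intro a ha haw
    rw [← hpid (ρ.asAlgebraHom a v) ⟨a, ⟨ha, haw⟩, rfl⟩, map_asAlgebraHom_of_mem hp ha, hpv,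
      map_zero]
  obtain ⟨l, hl⟩ := LinearMap.exists_comp_eq_of_ker_le
    (σ.orbitMap w ∘ₗ (subgroupAlgebra (M : Subgroup G)).toSubmodule.subtype)
    (ρ.orbitMap v ∘ₗ (subgroupAlgebra (M : Subgroup G)).toSubmodule.subtype)
    fun a h => hker a a.2 h
  replace hl : ∀ a ∈ subgroupAlgebra (M : Subgroup G),
      l (σ.asAlgebraHom a w) = ρ.asAlgebraHom a v := fun a ha => hl ⟨a, ha⟩
  let S : Submodule ℂ Y :=
    Submodule.map (σ.orbitMap w) (subgroupAlgebra (M : Subgroup G)).toSubmodule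
  obtain ⟨p, hpS, hpid, hp⟩ := hσ.exists_equivariant_projection (M : Subgroup G) hM S (by
    rintro m hm _ ⟨a, ha, rfl⟩
    exact ⟨MonoidAlgebra.of ℂ G m * a, hmul hm ha, by simp⟩)
  -- Project equivariantly onto `ℂ[M] w`, identify with `ℂ[M] v`, then apply `ξ`; this is fixed by
  -- the part of `M` fixing `ξ`.
  refine ⟨ξ ∘ₗ l ∘ₗ p, ?_, fun a ha => ?_⟩
  · obtain ⟨U, hU⟩ := hξ.exists_openSubgroup
    refine isSmoothVector_of_openSubgroup (U ⊓ M) fun g hg => ?_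
    obtain ⟨hgU, hgM⟩ := OpenSubgroup.mem_inf.mp hg
    ext y
    obtain ⟨a, ha, hay⟩ := hpS y
    have hay' : σ.asAlgebraHom a w = p y := hay
    have hgM' : g⁻¹ ∈ (M : Subgroup G) := inv_mem hgM
    have h1 := hl _ (hmul hgM' ha)
    rw [map_mul, Module.End.mul_apply, hay', asAlgebraHom_of, map_mul, Module.End.mul_apply,
      asAlgebraHom_of] at h1
    have h2 : ξ (ρ g⁻¹ (ρ.asAlgebraHom a v)) = ξ (ρ.asAlgebraHom a v) :=
      LinearMap.congr_fun (hU g hgU) _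
    change ξ (l (p (σ g⁻¹ y))) = ξ (l (p y))
    rw [hp _ hgM', h1, h2, ← hay', hl a ha]
  · change ξ (l (p _)) = _
    rw [hpid (σ.asAlgebraHom a w) ⟨a, ha, rfl⟩, hl a ha]

/-- If the `M`-type of `v` has multiplicity one in `ρ` and `ρ` is the only irreducible smooth
representation containing it, then every relation satisfied by `v` is satisfied by all vectors of
this type. -/
theorem asAlgebraHom_eq_zero_of_mem_typeSubspace (M : OpenSubgroup G) (hM : IsCompact (M : Set G))
    (hline : ∀ u ∈ typeSubspace ρ v (M : Subgroup G) ρ, ∃ c : ℂ, u = c • v)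
    (huniq : ∀ J : Ideal (MonoidAlgebra ℂ G), J.IsMaximal → (quotientRep J).IsSmooth →
      Submodule.Quotient.mk 1 ∈ typeSubspace ρ v (M : Subgroup G) (quotientRep J) →
      Nonempty ((quotientRep J).Equiv ρ))
    (hσ : σ.IsSmooth) {x : Y} (hx : x ∈ typeSubspace ρ v (M : Subgroup G) σ)
    (a : MonoidAlgebra ℂ G) (ha : ρ.asAlgebraHom a v = 0) : σ.asAlgebraHom a x = 0 := by
  by_contra hax
  obtain ⟨N, hN, hMN, haN⟩ := exists_le_mem_subgroupAlgebra M hM a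
  -- Projecting to `ℂ[N] a x` replaces `x` by `p x`, which has the same image `a x` under `a` and is
  -- recovered from it: `b a (p x) = p x`. This relation passes to every quotient of the module
  -- generated by `p x`.
  let S : Submodule ℂ Y := Submodule.map (σ.orbitMap (σ.asAlgebraHom a x))
    (subgroupAlgebra (N : Subgroup G)).toSubmodule
  obtain ⟨p, hpS, hpid, hp⟩ := hσ.exists_equivariant_projection (N : Subgroup G) hN S (by
    rintro m hm _ ⟨b, hb, rfl⟩
    exact ⟨MonoidAlgebra.of ℂ G m * b, (subgroupAlgebra (N : Subgroup G)).mul_mem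
      (of_mem_subgroupAlgebra hm) hb, by simp⟩)
  have hpa : σ.asAlgebraHom a (p x) = σ.asAlgebraHom a x := by
    rw [← map_asAlgebraHom_of_mem hp haN]
    exact hpid _ ⟨1, (subgroupAlgebra (N : Subgroup G)).one_mem, by simp⟩
  have hpx : p x ≠ 0 := fun h => hax (by rw [← hpa, h, map_zero])
  obtain ⟨b, hb, hbx⟩ := hpS x
  replace hbx : σ.asAlgebraHom b (σ.asAlgebraHom a x) = p x := hbx
  have hs : σ.asAlgebraHom (b * a) (p x) = p x := by
    rw [map_mul, Module.End.mul_apply, hpa, hbx]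
  have hpT : p x ∈ typeSubspace ρ v (M : Subgroup G) σ :=
    map_mem_typeSubspace (fun m hm => hp m (hMN hm)) hx
  let I : Ideal (MonoidAlgebra ℂ G) :=
    { carrier := {c | σ.asAlgebraHom c (p x) = 0}
      add_mem' := fun {c d} hc hd => by
        simp only [Set.mem_ofPred_eq] at hc hd ⊢
        rw [map_add, LinearMap.add_apply, hc, hd, add_zero]
      zero_mem' := by simp
      smul_mem' := fun c d hd => by
        simp only [Set.mem_ofPred_eq] at hd ⊢
        rw [smul_eq_mul, map_mul, Module.End.mul_apply, hd, map_zero] }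
  have hI : I ≠ ⊤ := fun h => hpx (by
    have : (1 : MonoidAlgebra ℂ G) ∈ I := h ▸ Submodule.mem_top
    simpa [I] using! this)
  -- The irreducible quotient contains the type, so it is `ρ` and its generator corresponds to `c •
  -- v`. Since `a v = 0`, the relation `1 - b a` forces the generator to vanish.
  obtain ⟨J, hJ, hIJ⟩ := Ideal.exists_le_maximal I hI
  have hmk {c : MonoidAlgebra ℂ G} (hc : σ.asAlgebraHom c (p x) = 0) :
      (quotientRep J).asAlgebraHom c (Submodule.Quotient.mk 1) = 0 := by
    rw [asAlgebraHom_quotientRep_mk_one]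
    exact (Submodule.Quotient.mk_eq_zero J).mpr (hIJ hc)
  have hJs : (quotientRep J).IsSmooth := by
    obtain ⟨U, -, hU⟩ := hσ.exists_compact_open_fixing (p x)
    refine isSmooth_of_generator (exists_asAlgebraHom_quotientRep_eq J) U fun g hg => ?_
    have := hmk (c := MonoidAlgebra.of ℂ G g - 1) (by simp [hU g hg])
    rw [map_sub, LinearMap.sub_apply, asAlgebraHom_of, sub_eq_zero] at this
    simpa using this
  have hJT : Submodule.Quotient.mk 1 ∈ typeSubspace ρ v (M : Subgroup G) (quotientRep J) :=
    fun c hc h => hmk (hpT c hc h)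
  obtain ⟨e⟩ := huniq J hJ hJs hJT
  obtain ⟨c, hc⟩ := hline _ (map_mem_typeSubspace (p := e.toIntertwiningMap.toLinearMap)
    (fun m _ y => IntertwiningMap.isIntertwining _ _ e.toIntertwiningMap m y) hJT)
  have h1 := hmk (c := b * a - 1) (by simp only [map_sub, LinearMap.sub_apply, hs]; simp)
  have h2 := e.toIntertwiningMap.map_asAlgebraHom (b * a - 1) (Submodule.Quotient.mk 1)
  rw [h1, map_zero] at h2
  replace hc : e.toIntertwiningMap (Submodule.Quotient.mk 1) = c • v := hc
  have h3 : c • v = 0 := by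
    rw [hc] at h2
    simpa [ha] using h2.symm
  have h4 : (Submodule.Quotient.mk 1 : MonoidAlgebra ℂ G ⧸ J) = 0 := by
    refine e.toLinearEquiv.map_eq_zero_iff.mp ?_
    exact hc.trans h3
  exact hJ.ne_top ((Ideal.eq_top_iff_one J).mpr ((Submodule.Quotient.mk_eq_zero J).mp h4))

end Smooth

end Representation

/-! ### Approximate matrix coefficients and smooth functionals -/

namespace Representation

section Estimate

variable {G : Type u} [Group G]
  {X : Type*} [AddCommGroup X] [Module ℂ X] {Y : Type*} [AddCommGroup Y] [Module ℂ Y]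

theorem asAlgebraHom_apply_eq_sum (ρ : Representation ℂ G X) (f : MonoidAlgebra ℂ G) (x : X) :
    ρ.asAlgebraHom f x = ∑ g ∈ f.coeff.support, f.coeff g • ρ g x := by
  rw [asAlgebraHom_def, MonoidAlgebra.lift_apply, Finsupp.sum, LinearMap.sum_apply]
  rfl

variable [TopologicalSpace G] [IsTopologicalGroup G]

/-- If the matrix coefficients of `w` are close to those of a `K`-fixed vector `v` on which the
element `f` of the group algebra acts as the identity, then `f` does not kill the `K`-average
of `w`. -/
theorem exists_fixed_asAlgebraHom_ne_zero {ρ : Representation ℂ G X} {σ : Representation ℂ G Y}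
    (hσ : σ.IsSmooth) (K : Subgroup G) (hK : IsCompact (K : Set G)) {v : X}
    (hv : ∀ k ∈ K, ρ k v = v) {f : MonoidAlgebra ℂ G} (hf : ρ.asAlgebraHom f v = v)
    {ξ : Module.Dual ℂ X} (hξ : ξ v = 1) {w : Y} {ζ : Module.Dual ℂ Y}
    (h : ∀ g ∈ f.coeff.support, ∀ k ∈ K, ‖ξ (ρ (g * k) v) - ζ (σ (g * k) w)‖ <
      (1 + ∑ g ∈ f.coeff.support, ‖f.coeff g‖)⁻¹) :
    ∃ w₀ : Y, (∀ k ∈ K, σ k w₀ = w₀) ∧ σ.asAlgebraHom f w₀ ≠ 0 := by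
  set s := ∑ g ∈ f.coeff.support, ‖f.coeff g‖ with hs
  have hs0 : 0 ≤ s := Finset.sum_nonneg fun _ _ => norm_nonneg _
  obtain ⟨w₀, hw₀, havg⟩ := hσ.exists_average K hK w
  refine ⟨w₀, hw₀, fun h0 => ?_⟩
  have hterm : ∀ g ∈ f.coeff.support, ‖ξ (ρ g v) - ζ (σ g w₀)‖ ≤ (1 + s)⁻¹ := fun g hg =>
    havg (ζ ∘ₗ σ g) (ξ (ρ g v)) _ fun k hk => by
      have := (h g hg k hk).le
      rwa [map_mul, map_mul, Module.End.mul_apply, Module.End.mul_apply, hv k hk] at this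
  -- If `f w₀ = 0`, then `1 = ξ (f v) - ζ (f w₀)` is a sum of norm at most `s / (1 + s) < 1`.
  have h1 : (1 : ℂ) = ∑ g ∈ f.coeff.support, f.coeff g * (ξ (ρ g v) - ζ (σ g w₀)) := by
    have h2 : ξ (ρ.asAlgebraHom f v) - ζ (σ.asAlgebraHom f w₀) = 1 := by
      rw [hf, h0, hξ, map_zero, sub_zero]
    rw [← h2, asAlgebraHom_apply_eq_sum, asAlgebraHom_apply_eq_sum, map_sum, map_sum,
      ← Finset.sum_sub_distrib]
    simp only [map_smul, smul_eq_mul, mul_sub]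
  have h3 : (1 : ℝ) ≤ s * (1 + s)⁻¹ := by
    calc (1 : ℝ) = ‖(1 : ℂ)‖ := by simp
      _ ≤ ∑ g ∈ f.coeff.support, ‖f.coeff g * (ξ (ρ g v) - ζ (σ g w₀))‖ := by
        rw [h1]
        exact norm_sum_le _ _
      _ ≤ ∑ g ∈ f.coeff.support, ‖f.coeff g‖ * (1 + s)⁻¹ := by
        refine Finset.sum_le_sum fun g hg => ?_
        rw [norm_mul]
        exact mul_le_mul_of_nonneg_left (hterm g hg) (norm_nonneg _)
      _ = s * (1 + s)⁻¹ := by rw [hs, Finset.sum_mul]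
  rw [← div_eq_mul_inv, le_div_iff₀ (by positivity)] at h3
  linarith

/-- A nonzero vector of a smooth representation fixed by a compact open subgroup is detected by
a smooth functional. -/
theorem IsSmooth.exists_isSmoothVector_dual {ρ : Representation ℂ G X} (hρ : ρ.IsSmooth)
    (K : OpenSubgroup G) (hK : IsCompact (K : Set G)) {v : X} (hv0 : v ≠ 0)
    (hv : ∀ k ∈ K, ρ k v = v) :
    ∃ ξ : Module.Dual ℂ X, ρ.dual.IsSmoothVector ξ ∧ ξ v = 1 := by
  have hspan {k : G} (hk : k ∈ K) {s : X} (hs : s ∈ Submodule.span ℂ {v}) : ρ k s = s := by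
    obtain ⟨c, rfl⟩ := Submodule.mem_span_singleton.mp hs
    rw [map_smul, hv k hk]
  -- `K` acts trivially on the line of `v`, so any functional composed with an equivariant
  -- projection to it is `K`-invariant.
  obtain ⟨p, hpS, hpid, hp⟩ := hρ.exists_equivariant_projection (K : Subgroup G) hK
    (Submodule.span ℂ {v}) fun k hk s hs => (hspan hk hs).symm ▸ hs
  obtain ⟨l, hl⟩ := Module.Projective.exists_dual_ne_zero ℂ hv0
  have hpv : p v = v := hpid v (Submodule.mem_span_singleton_self v)
  refine ⟨(l v)⁻¹ • l ∘ₗ p, isSmoothVector_of_openSubgroup K fun k hk => ?_, ?_⟩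
  · ext x
    change (l v)⁻¹ • l (p (ρ k⁻¹ x)) = (l v)⁻¹ • l (p x)
    rw [hp _ (inv_mem hk), hspan (inv_mem hk) (hpS x)]
  · change (l v)⁻¹ • l (p v) = 1
    rw [hpv, smul_eq_mul, inv_mul_cancel₀ hl]

end Estimate

end Representation

/-! ### The category of smooth representations -/

section Category

open Representation

variable {G : Type u} [Group G] [TopologicalSpace G]

namespace SmoothRep

/-- The object of the category of smooth representations given by a smooth representation. -/
abbrev of {X : Type u} [AddCommGroup X] [Module ℂ X] {ρ : Representation ℂ G X}
    (hρ : ρ.IsSmooth) : SmoothRep G :=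
  ⟨Rep.of ρ, hρ⟩

/-- The morphism of smooth representations given by an intertwining map. -/
def homMk {V W : SmoothRep G} (f : IntertwiningMap V.obj.ρ W.obj.ρ) : V ⟶ W :=
  ObjectProperty.homMk (Rep.ofHom f)

/-- The intertwining map underlying a morphism of smooth representations. -/
def toMap {V W : SmoothRep G} (f : V ⟶ W) : IntertwiningMap V.obj.ρ W.obj.ρ :=
  f.hom.hom

theorem hom_ext {V W : SmoothRep G} {f g : V ⟶ W} (h : ∀ x, toMap f x = toMap g x) : f = g :=
  ObjectProperty.hom_ext _ (Rep.hom_ext (IntertwiningMap.ext (LinearMap.ext h)))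

theorem toMap_comp_apply {V W Z : SmoothRep G} (f : V ⟶ W) (g : W ⟶ Z) (x : V.obj.V) :
    toMap (f ≫ g) x = toMap g (toMap f x) := rfl

theorem epi_of_surjective {V W : SmoothRep G} (f : V ⟶ W) (hf : Function.Surjective (toMap f)) :
    Epi f where
  left_cancellation g h hgh := hom_ext fun x => by
    obtain ⟨y, rfl⟩ := hf x
    rw [← toMap_comp_apply, hgh, toMap_comp_apply]

/-- The quotient by the range is again smooth, so the quotient map and zero are two morphisms in the
category agreeing after `f`. -/
theorem surjective_of_epi [IsTopologicalGroup G] {V W : SmoothRep G} (f : V ⟶ W) [Epi f] :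
    Function.Surjective (toMap f) := by
  let R := (toMap f).range
  let q := Representation.quotient W.obj.ρ R.toSubmodule
    fun g _ hx => R.apply_mem_toSubmodule g hx
  have hq : q.IsSmooth := by
    rw [isSmooth_iff]
    intro x
    obtain ⟨x, rfl⟩ := Submodule.Quotient.mk_surjective _ x
    obtain ⟨U, hU⟩ := ((isSmooth_iff _).mp W.property x).exists_openSubgroup
    exact isSmoothVector_of_openSubgroup U fun g hg =>
      congrArg (Submodule.Quotient.mk (p := R.toSubmodule)) (hU g hg)
  let mk : W ⟶ of hq := homMk ⟨R.toSubmodule.mkQ, fun g => rfl⟩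
  have h : mk = homMk 0 := by
    rw [← cancel_epi f]
    refine hom_ext fun x => ?_
    exact (Submodule.Quotient.mk_eq_zero R.toSubmodule).mpr ⟨x, rfl⟩
  intro y
  have hy : toMap mk y = 0 := by
    rw [h]
    rfl
  exact (Submodule.Quotient.mk_eq_zero R.toSubmodule).mp hy

theorem nonempty_iso_of_equiv {V W : SmoothRep G} (e : V.obj.ρ.Equiv W.obj.ρ) :
    Nonempty (V ≅ W) :=
  ⟨ObjectProperty.isoMk _ (Rep.mkIso e)⟩

end SmoothRep

theorem IrrSmoothRep.toDual_eq_of_equiv {π σ : IrrSmoothRep G} (e : π.act.Equiv σ.act) :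
    π.toDual = σ.toDual := by
  obtain ⟨i⟩ := SmoothRep.nonempty_iso_of_equiv (V := π.obj) (W := σ.obj) e
  exact Quotient.sound ⟨ObjectProperty.isoMk _ i⟩

theorem IrrSmoothRep.nonempty_iso_of_toDual_eq {π σ : IrrSmoothRep G} (h : π.toDual = σ.toDual) :
    Nonempty (π.obj ≅ σ.obj) := by
  obtain ⟨i⟩ : Nonempty (π ≅ σ) := Quotient.exact h
  exact ⟨(ObjectProperty.ι _).mapIso i⟩

theorem IrrSmoothRep.nonempty_equiv_of_toDual_eq {π σ : IrrSmoothRep G} (h : π.toDual = σ.toDual) :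
    Nonempty (π.act.Equiv σ.act) := by
  obtain ⟨i⟩ := nonempty_iso_of_toDual_eq h
  exact ⟨equivOfIso ((ObjectProperty.ι _).mapIso i)⟩

theorem IrrSmoothRep.exists_ne_zero (π : IrrSmoothRep G) : ∃ v : π.Space, v ≠ 0 := by
  by_contra! h
  have hirr : π.act.IsIrreducible := π.property
  refine bot_ne_top (α := Subrepresentation π.act) ?_
  refine Subrepresentation.toSubmodule_injective ?_
  ext x
  simp [h x]

/-! ### The two implications -/

variable [IsEllCGroup G]

/-- A projective irreducible smooth representation has a Fell neighbourhood containing no other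
irreducible smooth representation. -/
theorem exists_fellNhd_subset_singleton (π : IrrSmoothRep G) (hπ : Projective π.obj) :
    ∃ (n : ℕ) (v : Fin n → π.Space) (ξ : Fin n → Module.Dual ℂ π.Space) (B : Set G) (ε : ℝ),
      (∀ j, π.act.dual.IsSmoothVector (ξ j)) ∧ IsCompact B ∧ 0 < ε ∧
        fellNhd π v ξ B ε ⊆ {π.toDual} := by
  have hirr : π.act.IsIrreducible := π.property
  have hsm : π.act.IsSmooth := π.obj.property
  obtain ⟨v, hv⟩ := π.exists_ne_zero
  obtain ⟨K, hK, hKv⟩ := hsm.exists_compact_open_fixing v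
  -- `ℂ[G] / J` is the universal representation generated by a `K`-fixed vector.
  let J : Ideal (MonoidAlgebra ℂ G) := Ideal.span ((fun k => MonoidAlgebra.of ℂ G k - 1) '' K)
  have hgen := exists_asAlgebraHom_quotientRep_eq J
  have hlift {Y : Type u} [AddCommGroup Y] [Module ℂ Y] (σ : Representation ℂ G Y) (y : Y)
      (hy : ∀ k ∈ K, σ k y = y) : ∃ t : IntertwiningMap (quotientRep J) σ,
        ∀ a, t (Submodule.Quotient.mk a) = σ.asAlgebraHom a y := by
    have hJ : ∀ a ∈ J, σ.asAlgebraHom a y = 0 := by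
      intro a ha
      induction ha using Submodule.span_induction with
      | mem a ha =>
        obtain ⟨k, hk, rfl⟩ := ha
        simp [hy k hk]
      | zero => simp
      | add a b _ _ ha hb => simp [ha, hb]
      | smul c a _ ha => simp [ha]
    obtain ⟨t, ht⟩ := exists_intertwiningMap hgen (σ := σ) y fun a ha => hJ a (by
      rw [asAlgebraHom_quotientRep_mk_one] at ha
      exact (Submodule.Quotient.mk_eq_zero J).mp ha)
    exact ⟨t, fun a => by rw [← ht, asAlgebraHom_quotientRep_mk_one]⟩
  have hJs : (quotientRep J).IsSmooth := isSmooth_of_generator hgen K fun k hk => by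
    have : (quotientRep J).asAlgebraHom (MonoidAlgebra.of ℂ G k - 1)
        (Submodule.Quotient.mk 1) = 0 := by
      rw [asAlgebraHom_quotientRep_mk_one]
      exact (Submodule.Quotient.mk_eq_zero J).mpr (Ideal.subset_span ⟨k, hk, rfl⟩)
    rw [map_sub, LinearMap.sub_apply, asAlgebraHom_of, sub_eq_zero] at this
    simpa using this
  obtain ⟨t, ht⟩ := hlift π.act v hKv
  let T : SmoothRep.of hJs ⟶ π.obj := SmoothRep.homMk t
  have : Epi T := SmoothRep.epi_of_surjective T fun u => by
    obtain ⟨a, rfl⟩ := hirr.exists_asAlgebraHom_eq hv u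
    exact ⟨Submodule.Quotient.mk a, ht a⟩
  obtain ⟨S, hS⟩ := hπ.factors (𝟙 π.obj) T
  -- `f` represents the image of `v` under the section, whence `f v = v`.
  obtain ⟨f, hf⟩ := Submodule.Quotient.mk_surjective J (SmoothRep.toMap S v)
  have hfv : π.act.asAlgebraHom f v = v := by
    have h1 : SmoothRep.toMap (S ≫ T) v = v := by
      rw [hS]
      rfl
    have h2 : t (SmoothRep.toMap S v) = v := h1
    rw [← ht f, hf, h2]
  obtain ⟨ξ, hξ, hξv⟩ := hsm.exists_isSmoothVector_dual K hK hv hKv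
  refine ⟨1, fun _ => v, fun _ => ξ, ⋃ g ∈ f.coeff.support, (fun k => g * k) '' (K : Set G),
    (1 + ∑ g ∈ f.coeff.support, ‖f.coeff g‖)⁻¹, fun _ => hξ, ?_, ?_, ?_⟩
  · exact f.coeff.support.isCompact_biUnion fun g _ => hK.image (continuous_const_mul g)
  · have : 0 ≤ ∑ g ∈ f.coeff.support, ‖f.coeff g‖ := Finset.sum_nonneg fun _ _ => norm_nonneg _
    positivity
  · rintro x ⟨σ, rfl, w, ζ, -, h⟩
    have hσirr : σ.act.IsIrreducible := σ.property
    obtain ⟨w₀, hw₀, hfw⟩ := exists_fixed_asAlgebraHom_ne_zero (ρ := π.act) (σ := σ.act)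
      σ.obj.property (K : Subgroup G) hK hKv hfv hξv (w := w 0) (ζ := ζ 0)
      fun g hg k hk => h 0 (g * k) (Set.mem_biUnion hg ⟨k, hk, rfl⟩)
    obtain ⟨r, hr⟩ := hlift σ.act w₀ hw₀
    -- The section followed by the map sending the universal vector to `w₀` takes `v` to `f w₀ ≠ 0`.
    let F : IntertwiningMap π.act σ.act := r.comp (SmoothRep.toMap S)
    have hF : F v = σ.act.asAlgebraHom f w₀ := by
      rw [← hr f, hf]
      rfl
    rcases IsIrreducible.bijective_or_eq_zero F with hb | h0
    · exact (IrrSmoothRep.toDual_eq_of_equiv (F.ofBijective hb)).symm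
    · refine absurd ?_ hfw
      rw [← hF, h0]
      rfl

/-- An irreducible admissible representation with a Fell neighbourhood containing no other
irreducible smooth representation is projective. -/
theorem projective_of_fellNhd_subset_singleton (π : IrrSmoothRep G) (hadm : π.act.IsAdmissible)
    {n : ℕ} {v : Fin n → π.Space} {ξ : Fin n → Module.Dual ℂ π.Space} {B : Set G} {ε : ℝ}
    (hξ : ∀ j, π.act.dual.IsSmoothVector (ξ j)) (hB : IsCompact B) (hε : 0 < ε)
    (h : fellNhd π v ξ B ε ⊆ {π.toDual}) : Projective π.obj := by
  have hirr : π.act.IsIrreducible := π.property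
  obtain ⟨v₀, hv₀⟩ := π.exists_ne_zero
  obtain ⟨M₁, hM₁, hline₁⟩ := hadm.exists_typeSubspace_le_span hirr hv₀
  obtain ⟨M₂, hM₂, hBM₂⟩ := exists_compact_open_superset hB
  obtain ⟨M₃, hM₃, h13, h23⟩ := IsEllCGroup.directed_compact_open M₁ M₂ hM₁ hM₂
  choose a ha using fun j => hirr.exists_asAlgebraHom_eq hv₀ (v j)
  -- `M` gives multiplicity one, contains `B`, and satisfies `v j ∈ ℂ[M] v₀` for all `j`.
  obtain ⟨M, hM, h3M, haM⟩ : ∃ M : OpenSubgroup G, IsCompact (M : Set G) ∧ M₃ ≤ M ∧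
      ∀ j, a j ∈ subgroupAlgebra (M : Subgroup G) := by
    have key (s : Finset (Fin n)) : ∃ M : OpenSubgroup G, IsCompact (M : Set G) ∧ M₃ ≤ M ∧
        ∀ j ∈ s, a j ∈ subgroupAlgebra (M : Subgroup G) := by
      induction s using Finset.induction_on with
      | empty => exact ⟨M₃, hM₃, le_rfl, by simp⟩
      | insert i s _ ih =>
        obtain ⟨M, hM, h3M, hs⟩ := ih
        obtain ⟨N, hN, hMN, hi⟩ := exists_le_mem_subgroupAlgebra M hM (a i)
        refine ⟨N, hN, h3M.trans hMN, fun j hj => ?_⟩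
        rcases Finset.mem_insert.mp hj with rfl | hj
        · exact hi
        · exact subgroupAlgebra_mono hMN (hs j hj)
    obtain ⟨M, hM, h3M, hs⟩ := key Finset.univ
    exact ⟨M, hM, h3M, fun j => hs j (Finset.mem_univ j)⟩
  have hline : ∀ u ∈ typeSubspace π.act v₀ (M : Subgroup G) π.act, ∃ c : ℂ, u = c • v₀ :=
    fun u hu => hline₁ u (typeSubspace_anti (h13.trans h3M) hu)
  have huniq : ∀ J : Ideal (MonoidAlgebra ℂ G), J.IsMaximal → (quotientRep J).IsSmooth →
      Submodule.Quotient.mk 1 ∈ typeSubspace π.act v₀ (M : Subgroup G) (quotientRep J) →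
      Nonempty ((quotientRep J).Equiv π.act) := by
    intro J hJ hJs hJT
    let σ : IrrSmoothRep G := ⟨SmoothRep.of hJs, isIrreducible_quotientRep hJ⟩
    have h1 : (Submodule.Quotient.mk 1 : MonoidAlgebra ℂ G ⧸ J) ≠ 0 := fun h0 =>
      hJ.ne_top ((Ideal.eq_top_iff_one J).mpr ((Submodule.Quotient.mk_eq_zero J).mp h0))
    choose ζ hζ hζe using fun j =>
      exists_matrix_coefficient_eq hadm.1 hJs M hM hline h1 hJT (hξ j)
    refine IrrSmoothRep.nonempty_equiv_of_toDual_eq (π := σ) (h ⟨σ, rfl,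
      fun j => (quotientRep J).asAlgebraHom (a j) (Submodule.Quotient.mk 1), ζ, hζ,
      fun j g hg => ?_⟩)
    have hgM : g ∈ (M : Subgroup G) := h3M (h23 (hBM₂ hg))
    have h2 := hζe j (MonoidAlgebra.of ℂ G g * a j)
      (mul_mem (of_mem_subgroupAlgebra hgM) (haM j))
    rw [map_mul, map_mul, Module.End.mul_apply, Module.End.mul_apply, asAlgebraHom_of,
      asAlgebraHom_of, ha j] at h2
    change ‖ξ j (π.act g (v j)) - ζ j (quotientRep J g _)‖ < ε
    rw [h2, sub_self, norm_zero]
    exact hε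
  refine ⟨fun {E X} f e _ => ?_⟩
  have hsurj := SmoothRep.surjective_of_epi e
  let F : IntertwiningMap π.act X.obj.ρ := SmoothRep.toMap f
  let e' : IntertwiningMap E.obj.ρ X.obj.ρ := SmoothRep.toMap e
  -- Subtracting the `M`-equivariant projection to the kernel of `e'` corrects a lift of `F v₀`: if
  -- `b v₀ = 0` with `b ∈ ℂ[M]`, then `b x'` lies in the kernel, so `b (x' - p x') = 0`.
  obtain ⟨p, hpS, hpid, hp⟩ := E.property.exists_equivariant_projection (M : Subgroup G) hM
    e'.ker.toSubmodule fun m _ s hs => e'.ker.apply_mem_toSubmodule m hs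
  obtain ⟨x', hx'⟩ := hsurj (F v₀)
  have hex : e' (x' - p x') = F v₀ := by
    have : e' (p x') = 0 := hpS x'
    rw [map_sub, this, sub_zero]
    exact hx'
  have hxT : x' - p x' ∈ typeSubspace π.act v₀ (M : Subgroup G) E.obj.ρ := by
    intro b hb hbv
    have : e' (E.obj.ρ.asAlgebraHom b x') = 0 := by
      have hx'' : e' x' = F v₀ := hx'
      rw [IntertwiningMap.map_asAlgebraHom, hx'', ← IntertwiningMap.map_asAlgebraHom, hbv, map_zero]
    rw [map_sub, ← map_asAlgebraHom_of_mem hp hb, hpid _ this, sub_self]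
  obtain ⟨s, hs⟩ := exists_intertwiningMap (hirr.exists_asAlgebraHom_eq hv₀) (x' - p x')
    (asAlgebraHom_eq_zero_of_mem_typeSubspace M hM hline huniq E.property hxT)
  refine ⟨SmoothRep.homMk s, SmoothRep.hom_ext fun u => ?_⟩
  obtain ⟨b, rfl⟩ := hirr.exists_asAlgebraHom_eq hv₀ u
  change e' (s (π.act.asAlgebraHom b v₀)) = F _
  rw [hs, IntertwiningMap.map_asAlgebraHom, hex, IntertwiningMap.map_asAlgebraHom]

end Category

/-- An irreducible smooth representation `π` of a tame `ℓ_c`-group `G` is a projective object of the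
category of smooth representations of `G` if and only if its class is an open point of the smooth
dual space for the Fell topology. -/
theorem mainTheorem8 (G : Type u) [Group G] [TopologicalSpace G] [IsEllCGroup G] (hG : IsTame G)
    (π : IrrSmoothRep G) :
    Projective π.obj ↔ IsOpen ({π.toDual} : Set (SmoothDual G)) := by
  constructor
  -- Openness is tested at every representative `π'` of the class, so projectivity is carried over
  -- to `π'`.
  · intro hπ π' hπ'
    have heq : π'.toDual = π.toDual := hπ'
    obtain ⟨i⟩ := IrrSmoothRep.nonempty_iso_of_toDual_eq heq
    have := exists_fellNhd_subset_singleton π' (Projective.of_iso i.symm hπ)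
    rwa [heq] at this
  · intro hopen
    obtain ⟨n, v, ξ, B, ε, hξ, hB, hε, h⟩ := hopen π rfl
    exact projective_of_fellNhd_subset_singleton π (hG π) hξ hB hε h
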